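/- A hypergraph is a pair $(V,E)$ with $V$ a finite vertex set and $E$ a finite multiset of edges, each edge being a multi-subset of $V$; the degree of a vertex is its total number of occurrences among all edges. An $r$-factor of a hypergraph is a spanning sub-hypergraph in which every vertex has degree $r$, and an $(r_1,\dots,r_k)$-factorization is a partition of the edge multiset into $F_1,\dots,F_k$ such that $F_i$ is an $r_i$-factor for $1\le i\le k$. A hypergraph is connected if any two of its vertices are linked by a finite sequence of vertices in which consecutive ones lie in a common edge. Let $\lambda K_n^h$ be the hypergraph on $n$ vertices whose edges are all $h$-subsets of the vertex set, each with multiplicity $\lambda$. Let $n,h,\lambda,k,r_1,\dots,r_k$ be positive integers with $n>h$. Then $\lambda K_n^h$ has an $(r_1,\dots,r_k)$-factorization if and only if $$h \mid r_i n\quad\text{for } 1\le i\le k,\qquad\text{and}\qquad \sum_{i=1}^k r_i=\lambda\binom{n-1}{h-1}.$$ Moreover, if $h\ge 2$ and these conditions hold, then $\lambda K_n^h$ has an $(r_1,\dots,r_k)$-factorization in which, simultaneously for all $i$ with $r_i\ge 2$, the $r_i$-factor $F_i$ is connected. -/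

import Mathlib

/-- A hypergraph with vertex set `V`: the edges form a multiset, and every edge is itself a
multi-subset of `V`. All hypergraphs over the same type `V` have the same vertex set, so
a sub-hypergraph over `V` is automatically spanning. -/
@[ext]
structure MultiHypergraph (V : Type*) where
  /-- The multiset of edges. -/
  edges : Multiset (Multiset V)

namespace MultiHypergraph

/-- The degree of `v`: the total number of occurrences of `v` among all edges. -/
def degree {V : Type*} [DecidableEq V] (G : MultiHypergraph V) (v : V) : ℕ :=
  (G.edges.map fun e => e.count v).sum

/-- `G` is `r`-regular if every vertex has degree `r`. -/
def IsRegular {V : Type*} [DecidableEq V] (G : MultiHypergraph V) (r : ℕ) : Prop :=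
  ∀ v : V, G.degree v = r

/-- Two vertices are joined if some edge contains both. -/
def Joined {V : Type*} (G : MultiHypergraph V) (u v : V) : Prop :=
  ∃ e ∈ G.edges, u ∈ e ∧ v ∈ e

/-- `G` is connected if it has a vertex and any two of its vertices are linked by a finite
chain of vertices in which consecutive ones lie in a common edge. -/
def Connected {V : Type*} (G : MultiHypergraph V) : Prop :=
  Nonempty V ∧ ∀ u v : V, Relation.ReflTransGen G.Joined u v

/-- `F` is an `r`-factor of `G`: a spanning `r`-regular sub-hypergraph. -/
def IsFactor {V : Type*} [DecidableEq V] (G : MultiHypergraph V) (r : ℕ)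
    (F : MultiHypergraph V) : Prop :=
  F.edges ≤ G.edges ∧ F.IsRegular r

/-- `F 0, …, F (k - 1)` is an `(r 0, …, r (k - 1))`-factorization of `G`: each `F i` is an
`r i`-factor of `G`, and the edge multisets of the `F i` partition the edge multiset of `G`
(multiplicities add up). -/
def IsFactorization {V : Type*} [DecidableEq V] (G : MultiHypergraph V) {k : ℕ}
    (r : Fin k → ℕ) (F : Fin k → MultiHypergraph V) : Prop :=
  (∀ i, G.IsFactor (r i) (F i)) ∧ ∑ i, (F i).edges = G.edges

/-- `l` copies of the complete `h`-uniform hypergraph on `V`: every `h`-subset of `V` is an edge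
of multiplicity `l`, and there are no other edges. -/
def complete (V : Type*) [Fintype V] (l h : ℕ) : MultiHypergraph V where
  edges := l • ((Finset.univ : Finset V).powersetCard h).val.map Finset.val

end MultiHypergraph

/-! Necessity is a count of incidences. For sufficiency, take abstract edges, `r i * n / h` of each
colour `i`, with no vertices chosen yet, and split off the vertices one at a time, as in proofs of
Baranyai's theorem by amalgamation. Suppose N = n - #M vertices remain. An edge with trace A has h -
#A open places and should receive the next vertex with weight (h - #A)/N. These weights add up to `r
i` over colour `i`, and to l * C(N-1, h-#B-1) over the edges of trace B with #B < h. Both are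
integers, so a 0-1 rounding of the weights that respects these sums continues the construction. It
exists because circulations can be rounded to integral ones (`exists_int_circulation`,
`exists_balanced_rounding`).

For connectedness, the edges of a colour are grouped into blocks linked through chosen vertices; the
new vertex merges all blocks that receive it. The rounding is also kept within one unit on every
block, and on the union of the blocks of a colour with at least two open places. Then the bound
#blocks + N ≤ r N + 1 persists, and every block keeps an open place while N > 0
(`card_blocks_after_merge`). At N = 0 the bound leaves at most one block. -/

/-! ### Integral circulations -/

open Finset in
/-- If every vertex met by a set of arcs is met at least twice, the arcs carry a nonzero
circulation. -/
theorem exists_ne_zero_circulation {W ι : Type*} [Fintype W] [DecidableEq W] [Fintype ι]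
    [DecidableEq ι] [Nonempty ι] (src tgt : ι → W)
    (hdeg : ∀ e v, (src e = v ∨ tgt e = v) → ∃ e', e' ≠ e ∧ (src e' = v ∨ tgt e' = v)) :
    ∃ d : ι → ℝ, d ≠ 0 ∧
      ∀ v, ∑ e, (if src e = v then d e else 0) = ∑ e, (if tgt e = v then d e else 0) := by
  classical
  let U : Finset W := univ.filter fun v => ∃ e, src e = v ∨ tgt e = v
  have hsU : ∀ e, src e ∈ U := fun e => mem_filter.2 ⟨mem_univ _, e, .inl rfl⟩
  have htU : ∀ e, tgt e ∈ U := fun e => mem_filter.2 ⟨mem_univ _, e, .inr rfl⟩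
  -- Every vertex of `U` carries at least two arc ends, and every arc has exactly two ends.
  have hcard : U.card ≤ Fintype.card ι := by
    have h1 : ∀ v ∈ U, 2 ≤ ∑ e : ι,
        ((if src e = v then 1 else 0) + (if tgt e = v then 1 else 0)) := by
      intro v hv
      obtain ⟨e, he⟩ := (mem_filter.1 hv).2
      obtain ⟨e', hne, he'⟩ := hdeg e v he
      have hpair : ∑ x ∈ ({e, e'} : Finset ι), 1 ≤
          ∑ x : ι, ((if src x = v then 1 else 0) + (if tgt x = v then 1 else 0)) := by
        refine (Finset.sum_le_sum ?_).trans (Finset.sum_le_sum_of_subset (subset_univ _))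
        intro x hx
        rcases mem_insert.1 hx with rfl | hx
        · rcases he with h | h <;> simp [h]
        · rw [mem_singleton] at hx
          subst hx
          rcases he' with h | h <;> simp [h]
      rw [sum_pair hne.symm] at hpair
      exact hpair
    have h2 := Finset.sum_le_sum h1
    rw [sum_comm] at h2
    have h3 : ∀ e : ι, ∑ v ∈ U,
        ((if src e = v then 1 else 0) + (if tgt e = v then 1 else 0)) = 2 := by
      intro e
      rw [sum_add_distrib, sum_ite_eq, sum_ite_eq, if_pos (hsU e), if_pos (htU e)]
    simp only [h3, sum_const, smul_eq_mul, card_univ] at h2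
    omega
  let φ : (ι → ℝ) →ₗ[ℝ] (U → ℝ) :=
    { toFun := fun d v => ∑ e, (if src e = v then d e else 0) - ∑ e, (if tgt e = v then d e else 0)
      map_add' := by
        intro x y
        ext v
        simp only [Pi.add_apply, ← sum_sub_distrib, ← sum_add_distrib]
        refine sum_congr rfl fun e _ => ?_
        split_ifs <;> ring
      map_smul' := by
        intro c x
        ext v
        simp only [Pi.smul_apply, smul_eq_mul, RingHom.id_apply, ← sum_sub_distrib, mul_sum]
        refine sum_congr rfl fun e _ => ?_
        split_ifs <;> ring }
  have hsum : ∀ d, ∑ v, φ d v = 0 := by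
    intro d
    change ∑ v : U, (∑ e, (if src e = v then d e else 0) - ∑ e, (if tgt e = v then d e else 0)) = 0
    rw [sum_sub_distrib, sum_comm, sum_comm (s := (univ : Finset U)), ← sum_sub_distrib]
    refine sum_eq_zero fun e _ => ?_
    have hs := sum_coe_sort U fun v => if src e = v then d e else 0
    have ht := sum_coe_sort U fun v => if tgt e = v then d e else 0
    rw [hs, ht, sum_ite_eq, sum_ite_eq, if_pos (hsU e), if_pos (htU e), sub_self]
  -- Net outflows sum to zero, so `φ` misses a unit vector; with at least as many arcs as vertices,
  -- injectivity would force surjectivity.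
  have hninj : ¬ Function.Injective φ := by
    intro hinj
    have hle := LinearMap.finrank_le_finrank_of_injective hinj
    rw [Module.finrank_fintype_fun_eq_card, Module.finrank_fintype_fun_eq_card,
      Fintype.card_coe] at hle
    have hsurj : Function.Surjective φ := by
      rw [← LinearMap.injective_iff_surjective_of_finrank_eq_finrank]
      · exact hinj
      · rw [Module.finrank_fintype_fun_eq_card, Module.finrank_fintype_fun_eq_card,
          Fintype.card_coe]
        exact le_antisymm hle hcard
    obtain ⟨e⟩ := ‹Nonempty ι›
    obtain ⟨d, hd⟩ := hsurj (Pi.single ⟨src e, hsU e⟩ 1)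
    have := hsum d
    rw [hd, sum_pi_single'] at this
    simp at this
  rw [← LinearMap.ker_eq_bot] at hninj
  obtain ⟨d, hd, hd0⟩ := Submodule.exists_mem_ne_zero_of_ne_bot hninj
  refine ⟨d, hd0, fun v => ?_⟩
  by_cases hv : v ∈ U
  · have := congrFun (LinearMap.mem_ker.1 hd) ⟨v, hv⟩
    exact sub_eq_zero.1 this
  · have : ∀ e, src e ≠ v ∧ tgt e ≠ v := fun e =>
      ⟨fun h => hv (h ▸ hsU e), fun h => hv (h ▸ htU e)⟩
    simp [fun e => (this e).1, fun e => (this e).2]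

open Finset in
/-- A fractional circulation can be moved inside its integral box so that one more arc becomes
integral. -/
theorem exists_circulation_more_integral {W ι : Type*} [Fintype W] [DecidableEq W] [Fintype ι]
    [DecidableEq ι] (src tgt : ι → W) (f : ι → ℝ)
    (hf : ∀ v, ∑ e, (if src e = v then f e else 0) = ∑ e, (if tgt e = v then f e else 0))
    (e₀ : ι) (he₀ : Int.fract (f e₀) ≠ 0) :
    ∃ g : ι → ℝ,
      (∀ v, ∑ e, (if src e = v then g e else 0) = ∑ e, (if tgt e = v then g e else 0)) ∧
      (∀ e, (⌊f e⌋ : ℝ) ≤ g e ∧ g e ≤ ⌈f e⌉) ∧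
      ∃ e, Int.fract (f e) ≠ 0 ∧ Int.fract (g e) = 0 := by
  classical
  have hdir : ∃ d : ι → ℝ, d ≠ 0 ∧ (∀ e, Int.fract (f e) = 0 → d e = 0) ∧
      ∀ v, ∑ e, (if src e = v then d e else 0) = ∑ e, (if tgt e = v then d e else 0) := by
    -- A fractional loop carries a circulation by itself. Without such loops, conservation forbids a
    -- vertex with exactly one fractional arc, so the previous lemma applies to the fractional arcs.
    by_cases hl : ∃ e, Int.fract (f e) ≠ 0 ∧ src e = tgt e
    · obtain ⟨e, he, hst⟩ := hl
      refine ⟨Pi.single e 1, by simp, fun e' he' => ?_, fun v => ?_⟩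
      · exact Pi.single_eq_of_ne (by rintro rfl; exact he he') _
      · refine sum_congr rfl fun x _ => ?_
        by_cases hx : x = e
        · rw [hx, hst]
        · simp [Pi.single_eq_of_ne hx]
    · push Not at hl
      let N := {e : ι // Int.fract (f e) ≠ 0}
      have : Nonempty N := ⟨⟨e₀, he₀⟩⟩
      obtain ⟨d, hd0, hd⟩ := exists_ne_zero_circulation (ι := N) (fun e => src e.1)
        (fun e => tgt e.1) (by
          rintro ⟨e, he⟩ v hev
          by_contra! hcon
          have hint : ∀ x, x ≠ e → (src x = v ∨ tgt x = v) → ∃ z : ℤ, (z : ℝ) = f x := by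
            intro x hx hxv
            by_contra hz
            have hfx : Int.fract (f x) ≠ 0 := fun h => hz ⟨⌊f x⌋, by
              have := Int.floor_add_fract (f x); rw [h, add_zero] at this; exact this⟩
            have := hcon ⟨x, hfx⟩ (fun h => hx (congrArg Subtype.val h))
            tauto
          have hz : ∀ s : ι → W, (∀ x, s x = v → src x = v ∨ tgt x = v) →
              ∃ z : ℤ, ∑ x ∈ univ.erase e, (if s x = v then f x else 0) = z := by
            intro s hs
            have : ∀ x : ι, ∃ z : ℤ, x ≠ e → (if s x = v then f x else 0) = z := by
              intro x
              by_cases hx : x ≠ e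
              · by_cases hsx : s x = v
                · obtain ⟨z, hz⟩ := hint x hx (hs x hsx)
                  exact ⟨z, fun _ => by rw [if_pos hsx, hz]⟩
                · exact ⟨0, fun _ => by simp [hsx]⟩
              · exact ⟨0, fun h => absurd h hx⟩
            choose z hz using this
            refine ⟨∑ x ∈ univ.erase e, z x, ?_⟩
            rw [Int.cast_sum]
            exact sum_congr rfl fun x hx => hz x (ne_of_mem_erase hx)
          obtain ⟨z₁, hz₁⟩ := hz src fun _ => .inl
          obtain ⟨z₂, hz₂⟩ := hz tgt fun _ => .inr
          have hv := hf v
          rw [← add_sum_erase _ _ (mem_univ e), ← add_sum_erase _ _ (mem_univ e), hz₁, hz₂] at hv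
          have hne := hl e he
          apply he
          rcases hev with h | h
          · have h' : tgt e ≠ v := fun h2 => hne (by rw [h2]; exact h)
            rw [if_pos h, if_neg h'] at hv
            have : f e = ((z₂ - z₁ : ℤ) : ℝ) := by push_cast; linarith
            rw [this, Int.fract_intCast]
          · have h' : src e ≠ v := fun h2 => hne (by rw [h2]; exact h.symm)
            rw [if_neg h', if_pos h] at hv
            have : f e = ((z₁ - z₂ : ℤ) : ℝ) := by push_cast; linarith
            rw [this, Int.fract_intCast])
      have hext : ∀ (s : ι → W) v, ∑ e, (if s e = v then
          (if h : Int.fract (f e) ≠ 0 then d ⟨e, h⟩ else 0) else 0) =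
          ∑ e : N, (if s e.1 = v then d e else 0) := by
        intro s v
        symm
        refine Fintype.sum_of_injective Subtype.val Subtype.val_injective _ _ ?_ ?_
        · intro e he
          have : Int.fract (f e) = 0 := by
            by_contra h
            exact he ⟨⟨e, h⟩, rfl⟩
          simp [this]
        · rintro ⟨e, he⟩
          simp [he]
      refine ⟨fun e => if h : Int.fract (f e) ≠ 0 then d ⟨e, h⟩ else 0, ?_, ?_, ?_⟩
      · intro h0
        apply hd0
        ext ⟨e, he⟩
        have := congrFun h0 e
        simpa [he] using this
      · intro e he
        simp [he]
      · intro v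
        rw [hext, hext]
        exact hd v
  obtain ⟨d, hd0, hdsupp, hd⟩ := hdir
  -- For `d e ≠ 0`, the time at which arc `e`, moving along `d`, reaches the end of its box. The arc
  -- that arrives first becomes integral while all others are still inside.
  let τ : ι → ℝ := fun e => if 0 < d e then (⌈f e⌉ - f e) / d e else (f e - ⌊f e⌋) / (-d e)
  obtain ⟨e₁, he₁⟩ := Function.ne_iff.1 hd0
  obtain ⟨m, hm, hmin⟩ := exists_min_image (univ.filter fun e => d e ≠ 0) τ
    ⟨e₁, by simpa using he₁⟩
  simp only [mem_filter, mem_univ, true_and] at hm hmin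
  have hτ0 : 0 ≤ τ m := by
    simp only [τ]
    split_ifs with h
    · exact div_nonneg (sub_nonneg.2 (Int.le_ceil _)) h.le
    · exact div_nonneg (sub_nonneg.2 (Int.floor_le _)) (by linarith)
  refine ⟨fun e => f e + τ m * d e, fun v => ?_, fun e => ?_, m, fun h => hm (hdsupp m h), ?_⟩
  · have hlin : ∀ s : ι → W, ∑ e, (if s e = v then f e + τ m * d e else 0) =
        ∑ e, (if s e = v then f e else 0) + τ m * ∑ e, (if s e = v then d e else 0) := by
      intro s
      rw [mul_sum, ← sum_add_distrib]
      refine sum_congr rfl fun e _ => ?_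
      split_ifs <;> ring
    rw [hlin, hlin, hf, hd]
  · have h1 := Int.floor_le (f e)
    have h2 := Int.le_ceil (f e)
    rcases lt_trichotomy (d e) 0 with h | h | h
    · have hle := hmin e h.ne
      have hτe : τ e = (f e - ⌊f e⌋) / (-d e) := if_neg (not_lt.2 h.le)
      rw [hτe, le_div_iff₀ (by linarith)] at hle
      have := mul_nonpos_of_nonneg_of_nonpos hτ0 h.le
      constructor <;> linarith
    · simp [h, h1, h2]
    · have hle := hmin e h.ne'
      have hτe : τ e = (⌈f e⌉ - f e) / d e := if_pos h
      rw [hτe, le_div_iff₀ h] at hle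
      have := mul_nonneg hτ0 h.le
      constructor <;> linarith
  · by_cases h : 0 < d m
    · have : f m + τ m * d m = (⌈f m⌉ : ℤ) := by
        have : τ m = (⌈f m⌉ - f m) / d m := if_pos h
        rw [this, div_mul_cancel₀ _ hm]; ring
      simp only [this, Int.fract_intCast]
    · have : f m + τ m * d m = (⌊f m⌋ : ℤ) := by
        have : τ m = (f m - ⌊f m⌋) / (-d m) := if_neg h
        rw [this, div_neg, neg_mul, div_mul_cancel₀ _ hm]; ring
      simp only [this, Int.fract_intCast]

open Finset in
/-- Every real circulation can be rounded to an integral circulation. -/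
theorem exists_int_circulation {W ι : Type*} [Fintype W] [DecidableEq W] [Fintype ι]
    [DecidableEq ι] (src tgt : ι → W) (f : ι → ℝ)
    (hf : ∀ v, ∑ e, (if src e = v then f e else 0) = ∑ e, (if tgt e = v then f e else 0)) :
    ∃ g : ι → ℤ,
      (∀ v, ∑ e, (if src e = v then g e else 0) = ∑ e, (if tgt e = v then g e else 0)) ∧
      ∀ e, ⌊f e⌋ ≤ g e ∧ g e ≤ ⌈f e⌉ := by
  classical
  induction hc : (univ.filter fun e => Int.fract (f e) ≠ 0).card using Nat.strong_induction_on
    generalizing f with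
  | _ c ih =>
    subst hc
    by_cases hint : ∃ e, Int.fract (f e) ≠ 0
    · obtain ⟨e₀, he₀⟩ := hint
      obtain ⟨f', hf', hbox, m, hm, hm'⟩ := exists_circulation_more_integral src tgt f hf e₀ he₀
      obtain ⟨g, hg, hgb⟩ := ih _ (by
        refine card_lt_card ((ssubset_iff_of_subset fun e => ?_).2
          ⟨m, by simpa using hm, by simpa using hm'⟩)
        simp only [mem_filter, mem_univ, true_and]
        intro he h0
        apply he
        obtain ⟨hb1, hb2⟩ := hbox e
        have hfe : f e = (⌊f e⌋ : ℤ) := by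
          have := Int.floor_add_fract (f e); rw [h0, add_zero] at this; exact this.symm
        have hce : (⌈f e⌉ : ℝ) = ⌊f e⌋ := by rw [hfe]; simp
        have : f' e = (⌊f e⌋ : ℤ) := le_antisymm (by rw [← hce]; exact hb2) hb1
        rw [this, Int.fract_intCast]) f' hf' rfl
      refine ⟨g, hg, fun e => ⟨?_, ?_⟩⟩
      · exact (Int.le_floor.2 (hbox e).1).trans (hgb e).1
      · exact (hgb e).2.trans (Int.ceil_le.2 (hbox e).2)
    · push Not at hint
      have hfl : ∀ e, f e = (⌊f e⌋ : ℤ) := fun e => by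
        have := Int.floor_add_fract (f e); rw [hint e, add_zero] at this; exact this.symm
      refine ⟨fun e => ⌊f e⌋, fun v => ?_, fun e => ⟨le_rfl, Int.floor_le_ceil _⟩⟩
      have := hf v
      have hcast : ∀ s : ι → W, ∑ e, (if s e = v then f e else 0) =
          ((∑ e, (if s e = v then ⌊f e⌋ else 0) : ℤ) : ℝ) := by
        intro s
        push_cast
        refine sum_congr rfl fun e _ => ?_
        split_ifs
        · exact hfl e
        · rfl
      rw [hcast, hcast] at this
      exact_mod_cast this

/-! ### Simultaneous rounding along partitions -/

open Finset in
theorem sum_ite_sum_fiber {E Q R K : Type*} [Fintype E] [Fintype Q] [DecidableEq Q] [DecidableEq R]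
    [AddCommMonoid K] (b : E → Q) (s : Q → R) (y : R) (w : E → K) :
    (∑ q, if s q = y then ∑ e with b e = q, w e else 0) = ∑ e with s (b e) = y, w e := by
  have h : ∀ q, (if s q = y then ∑ e with b e = q, w e else 0) =
      ∑ e with b e = q, if s (b e) = y then w e else 0 := by
    intro q
    split_ifs with hq
    · refine sum_congr rfl fun e he => ?_
      rw [(mem_filter.1 he).2, if_pos hq]
    · refine (sum_eq_zero fun e he => ?_).symm
      rw [(mem_filter.1 he).2, if_neg hq]
  rw [sum_congr rfl fun q _ => h q, sum_fiberwise, sum_filter]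

open Finset in
/-- Simultaneous rounding of `d / N` along a partition and along a chain of three
successively coarser partitions of a finite set. -/
theorem exists_balanced_rounding {E P Q R T : Type*} [Fintype E] [Fintype P] [Fintype Q]
    [Fintype R] [Fintype T] [DecidableEq E] [DecidableEq P] [DecidableEq Q] [DecidableEq R]
    [DecidableEq T] (a : E → P) (b : E → Q) (s : Q → R) (t : R → T) (N : ℕ) (hN : 0 < N)
    (d : E → ℤ) :
    ∃ x : E → ℤ, (∀ e, |N * x e - d e| < N) ∧
      (∀ p, |N * ∑ e with a e = p, x e - ∑ e with a e = p, d e| < N) ∧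
      (∀ q, |N * ∑ e with b e = q, x e - ∑ e with b e = q, d e| < N) ∧
      (∀ y, |N * ∑ e with s (b e) = y, x e - ∑ e with s (b e) = y, d e| < N) ∧
      (∀ z, |N * ∑ e with t (s (b e)) = z, x e - ∑ e with t (s (b e)) = z, d e| < N) := by
  classical
  -- The network runs root → P → Q → R → T → root. Each `e` is an arc from `a e` to `b e`, and each
  -- class has one further arc whose flow is the sum over that class, so rounding this arc rounds
  -- the sum.
  let src : E ⊕ P ⊕ Q ⊕ R ⊕ T → Unit ⊕ P ⊕ Q ⊕ R ⊕ T :=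
    Sum.elim (fun e => .inr (.inl (a e))) (Sum.elim (fun _ => .inl ()) fun y => .inr (.inr y))
  let tgt : E ⊕ P ⊕ Q ⊕ R ⊕ T → Unit ⊕ P ⊕ Q ⊕ R ⊕ T :=
    Sum.elim (fun e => .inr (.inr (.inl (b e)))) (Sum.elim (fun p => .inr (.inl p))
      (Sum.elim (fun q => .inr (.inr (.inr (.inl (s q)))))
        (Sum.elim (fun y => .inr (.inr (.inr (.inr (t y))))) fun _ => .inl ())))
  let w : E → ℝ := fun e => d e / N
  let f : E ⊕ P ⊕ Q ⊕ R ⊕ T → ℝ :=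
    Sum.elim w (Sum.elim (fun p => ∑ e with a e = p, w e) (Sum.elim (fun q => ∑ e with b e = q, w e)
      (Sum.elim (fun y => ∑ e with s (b e) = y, w e) fun z => ∑ e with t (s (b e)) = z, w e)))
  obtain ⟨g, hg, hgf⟩ := exists_int_circulation src tgt f (by
    rintro (_ | p | q | y | z)
    · simp [src, tgt, f, sum_fiberwise]
    · simp [src, tgt, f, sum_filter]
    · simp [src, tgt, f, sum_filter]
    · simp [src, tgt, f, sum_ite_sum_fiber]
    · simp [src, tgt, f, sum_ite_sum_fiber (fun e => s (b e))])
  have hP : ∀ p, g (.inr (.inl p)) = ∑ e with a e = p, g (.inl e) := by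
    intro p
    have := hg (.inr (.inl p))
    simp [src, tgt] at this
    rw [sum_filter, this]
  have hQ : ∀ q, g (.inr (.inr (.inl q))) = ∑ e with b e = q, g (.inl e) := by
    intro q
    have := hg (.inr (.inr (.inl q)))
    simp [src, tgt] at this
    rw [sum_filter, this]
  have hR : ∀ y, g (.inr (.inr (.inr (.inl y)))) = ∑ e with s (b e) = y, g (.inl e) := by
    intro y
    have := hg (.inr (.inr (.inr (.inl y))))
    simp [src, tgt, hQ, sum_ite_sum_fiber] at this
    exact this
  have hT : ∀ z, g (.inr (.inr (.inr (.inr z)))) = ∑ e with t (s (b e)) = z, g (.inl e) := by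
    intro y
    have := hg (.inr (.inr (.inr (.inr y))))
    simp [src, tgt, hR, sum_ite_sum_fiber (fun e => s (b e))] at this
    exact this
  have key : ∀ (S : Finset E) (z : ℤ), ⌊∑ e ∈ S, w e⌋ ≤ z → z ≤ ⌈∑ e ∈ S, w e⌉ →
      |N * z - ∑ e ∈ S, d e| < N := by
    intro S z h1 h2
    have hN' : (0 : ℝ) < N := by exact_mod_cast hN
    have hw : (N : ℝ) * ∑ e ∈ S, w e = ((∑ e ∈ S, d e : ℤ) : ℝ) := by
      rw [mul_sum]
      push_cast
      exact sum_congr rfl fun e _ => mul_div_cancel₀ _ hN'.ne'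
    have h3 : ∑ e ∈ S, w e < z + 1 := by
      have := Int.lt_floor_add_one (∑ e ∈ S, w e)
      have : (⌊∑ e ∈ S, w e⌋ : ℝ) ≤ z := by exact_mod_cast h1
      linarith
    have h4 : (z : ℝ) < ∑ e ∈ S, w e + 1 := by
      have := Int.ceil_lt_add_one (∑ e ∈ S, w e)
      have : (z : ℝ) ≤ ⌈∑ e ∈ S, w e⌉ := by exact_mod_cast h2
      linarith
    have h5 := mul_lt_mul_of_pos_left h3 hN'
    have h6 := mul_lt_mul_of_pos_left h4 hN'
    rw [hw] at h5
    rw [mul_add, hw] at h6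
    rw [abs_lt]
    have h5' : (∑ e ∈ S, d e : ℤ) < N * (z + 1) := by exact_mod_cast h5
    have h6' : N * z < (∑ e ∈ S, d e : ℤ) + N * 1 := by exact_mod_cast h6
    constructor <;> linarith
  refine ⟨fun e => g (.inl e), fun e => ?_, fun p => ?_, fun q => ?_, fun y => ?_, fun z => ?_⟩
  · have := key {e} (g (.inl e))
    simp only [sum_singleton] at this
    exact this (hgf (.inl e)).1 (hgf (.inl e)).2
  · rw [← hP]
    exact key _ _ (hgf (.inr (.inl p))).1 (hgf (.inr (.inl p))).2
  · rw [← hQ]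
    exact key _ _ (hgf (.inr (.inr (.inl q)))).1 (hgf (.inr (.inr (.inl q)))).2
  · rw [← hR]
    exact key _ _ (hgf (.inr (.inr (.inr (.inl y))))).1 (hgf (.inr (.inr (.inr (.inl y))))).2
  · rw [← hT]
    exact key _ _ (hgf (.inr (.inr (.inr (.inr z))))).1 (hgf (.inr (.inr (.inr (.inr z))))).2

/-! ### Counting blocks under a merge -/

open Finset in
/-- Merging the blocks `q` with `X q ≠ 0` of a balanced selection keeps the number of blocks small
and leaves the merged block with a positive remainder. -/
theorem card_blocks_after_merge {Q : Type*} (L : Finset Q) (D X : Q → ℤ) (N r : ℤ) (hN : 1 ≤ N)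
    (hD : ∀ q ∈ L, 1 ≤ D q) (hX : ∀ q ∈ L, 0 ≤ X q) (hXD : ∀ q ∈ L, X q ≤ D q)
    (hbal : ∀ q ∈ L, |N * X q - D q| < N) (hsumD : ∑ q ∈ L, D q = N * r)
    (hsumX : ∑ q ∈ L, X q = r) (hL : (#L : ℤ) + N ≤ r * N + 1)
    (hS : |N * ∑ q ∈ L with 2 ≤ D q, X q - ∑ q ∈ L with 2 ≤ D q, D q| < N) :
    (#{q ∈ L | X q = 0} : ℤ) + N ≤ r * (N - 1) + 1 ∧
      (2 ≤ N → 1 ≤ ∑ q ∈ L with X q ≠ 0, (D q - X q)) := by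
  classical
  have hcard : (#{q ∈ L | X q = 0} : ℤ) + #{q ∈ L | X q ≠ 0} = #L := by
    exact_mod_cast card_filter_add_card_filter_not (s := L) (fun q => X q = 0)
  have hXT : ∑ q ∈ L with X q ≠ 0, X q = r := by rw [sum_filter_ne_zero, hsumX]
  constructor
  -- A block with X ≥ 2 keeps at least (N-1)(X-1) ≥ N-1 open places, and untouched blocks use at
  -- least one place each out of the r(N-1) that remain. If instead all X ≤ 1, exactly r blocks are
  -- touched and disappear from the count.
  · by_cases hbig : ∃ q ∈ L, 2 ≤ X q
    · obtain ⟨q, hq, hq2⟩ := hbig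
      have h1 : N - 1 ≤ D q - X q := by
        have := (abs_lt.1 (hbal q hq)).2
        nlinarith
      have h2 : D q - X q ≤ ∑ q ∈ L with X q ≠ 0, (D q - X q) :=
        single_le_sum (f := fun q => D q - X q)
          (fun p hp => sub_nonneg.2 (hXD p (mem_filter.1 hp).1))
          (mem_filter.2 ⟨hq, by omega⟩)
      have h3 : (#{q ∈ L | X q = 0} : ℤ) ≤ ∑ q ∈ L with X q = 0, D q := by
        have := sum_le_sum (s := {q ∈ L | X q = 0}) (f := fun _ => (1 : ℤ))
          fun q hq => hD q (mem_filter.1 hq).1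
        simpa using this
      have h4 := sum_filter_add_sum_filter_not L (fun q => X q = 0) D
      rw [sum_sub_distrib, hXT] at h2
      rw [hsumD] at h4
      simp only [ne_eq] at h2
      linarith
    · push Not at hbig
      have h1 : (#{q ∈ L | X q ≠ 0} : ℤ) = r := by
        rw [← hXT, card_eq_sum_ones]
        push_cast
        refine sum_congr rfl fun q hq => ?_
        obtain ⟨hq, h0⟩ := mem_filter.1 hq
        have := hbig q hq
        have := hX q hq
        omega
      linarith
  · intro hN2
    have hcard2 : (#{q ∈ L | 2 ≤ D q} : ℤ) + #{q ∈ L | ¬ 2 ≤ D q} = #L := by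
      exact_mod_cast card_filter_add_card_filter_not (s := L) (fun q => 2 ≤ D q)
    have hsplit := sum_filter_add_sum_filter_not L (fun q => 2 ≤ D q) D
    have hone : ∑ q ∈ L with ¬ 2 ≤ D q, D q = #{q ∈ L | ¬ 2 ≤ D q} := by
      rw [card_eq_sum_ones]
      push_cast
      refine sum_congr rfl fun q hq => ?_
      obtain ⟨hq, h0⟩ := mem_filter.1 hq
      have := hD q hq
      omega
    -- If all blocks had one open place, there would be r N of them, contradicting `hL` for N ≥ 2.
    -- The same count gives the large blocks at least N places in total, so `hS` forces one of them
    -- to be touched; it cannot be filled up, since (N-1) D ≥ N when D ≥ 2.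
    have hSne : 1 ≤ (#{q ∈ L | 2 ≤ D q} : ℤ) := by
      by_contra hlt
      have h0 : #{q ∈ L | 2 ≤ D q} = 0 := by omega
      rw [card_eq_zero.1 h0, sum_empty, hone, hsumD] at hsplit
      rw [h0] at hcard2
      push_cast at hcard2
      linarith
    have hDS : N ≤ ∑ q ∈ L with 2 ≤ D q, D q := by linarith
    have hpos : 0 < ∑ q ∈ L with 2 ≤ D q, X q := by
      have := (abs_lt.1 hS).1
      by_contra hle
      push Not at hle
      nlinarith
    obtain ⟨q, hq, hq0⟩ := exists_ne_zero_of_sum_ne_zero hpos.ne'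
    obtain ⟨hq, hq2⟩ := mem_filter.1 hq
    have h1 : 1 ≤ D q - X q := by
      have := (abs_lt.1 (hbal q hq)).2
      by_contra hlt
      have : X q = D q := le_antisymm (hXD q hq) (by omega)
      nlinarith
    exact h1.trans (single_le_sum (f := fun q => D q - X q)
      (fun p hp => sub_nonneg.2 (hXD p (mem_filter.1 hp).1)) (mem_filter.2 ⟨hq, hq0⟩))

/-! ### Splitting off one vertex -/

open Finset in
/-- The trace on the vertex set `M` of an edge-coloured `l`-fold complete `h`-uniform hypergraph on
`n` vertices: the edge `e` has trace `A e`, and its remaining `h - #(A e)` vertices are not yet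
chosen. The map `lab` names blocks of edges that are linked inside `M`; for the colours in `C`
there are few blocks and each of them still has a vertex to be chosen. -/
structure IsPartialFactorization {V E K : Type*} [DecidableEq V] [Fintype E] [DecidableEq E]
    [DecidableEq K] (color : E → K) (r : K → ℕ) (C : Set K) (n h l : ℕ) (M : Finset V)
    (A : E → Finset V) (lab : E → E) : Prop where
  subset : ∀ e, A e ⊆ M
  card_le : ∀ e, #(A e) ≤ h
  card_trace : ∀ B ⊆ M, #B ≤ h → #{e | A e = B} = l * (n - #M).choose (h - #B)
  degree : ∀ i, ∀ v ∈ M, #{e | color e = i ∧ v ∈ A e} = r i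
  color_lab : ∀ e, color (lab e) = color e
  linked : ∀ e e', lab e = lab e' →
    Relation.ReflTransGen (fun a b => color a = color b ∧ ¬ Disjoint (A a) (A b)) e e'
  card_lab : ∀ i ∈ C, #(image lab {e | color e = i}) + (n - #M) ≤ r i * (n - #M) + 1
  room : ∀ i ∈ C, #M < n → ∀ e, color e = i → 1 ≤ ∑ e' with lab e' = lab e, ((h : ℤ) - #(A e'))

namespace IsPartialFactorization

open Finset

variable {V E K : Type*} [DecidableEq V] [Fintype E] [DecidableEq E]
    [DecidableEq K] {color : E → K} {r : K → ℕ} {C : Set K} {n h l : ℕ} {M : Finset V}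
    {A : E → Finset V} {lab : E → E}

theorem sum_card (H : IsPartialFactorization color r C n h l M A lab) (i : K) :
    ∑ e with color e = i, #(A e) = #M * r i := by
  have h1 : ∀ e, #(A e) = ∑ v ∈ M, if v ∈ A e then 1 else 0 := by
    intro e
    rw [← card_filter, filter_mem_eq_inter, inter_eq_right.2 (H.subset e)]
  simp_rw [h1]
  rw [sum_comm, ← smul_eq_mul, ← sum_const]
  refine sum_congr rfl fun v hv => ?_
  rw [← card_filter, filter_filter, H.degree i v hv]

/-- Colour `i` has `r i * n` places in all, of which `#M * r i` are already filled. -/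
theorem sum_room (H : IsPartialFactorization color r C n h l M A lab) (hM : #M ≤ n) (i : K)
    (hcol : #{e | color e = i} * h = r i * n) :
    ∑ e with color e = i, ((h : ℤ) - #(A e)) = (n - #M : ℕ) * r i := by
  rw [sum_sub_distrib, sum_const, nsmul_eq_mul]
  have h1 : ((∑ e with color e = i, #(A e) : ℕ) : ℤ) = _ := congrArg _ (H.sum_card i)
  have h2 : ((#{e | color e = i} * h : ℕ) : ℤ) = _ := congrArg _ hcol
  push_cast [hM] at h1 h2 ⊢
  rw [h1, h2]
  ring

/-- Otherwise the binomial coefficient counting the edges with the trace of `e` would vanish,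
although `e` is one of them. This keeps the weights at most 1. -/
theorem le_room (H : IsPartialFactorization color r C n h l M A lab) (e : E) :
    h - #(A e) ≤ n - #M := by
  by_contra hlt
  have h1 := H.card_trace (A e) (H.subset e) (H.card_le e)
  rw [Nat.choose_eq_zero_of_lt (by omega), mul_zero, card_eq_zero] at h1
  have : e ∈ ({e' | A e' = A e} : Finset E) := by simp
  rw [h1] at this
  simp at this

/-- The edges that receive the next vertex can be chosen in a balanced way. -/
theorem exists_selection [Fintype V] [Fintype K]
    (H : IsPartialFactorization color r C n h l M A lab) (hM : #M < n)
    (hcol : ∀ i, #{e | color e = i} * h = r i * n) :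
    ∃ x : E → ℤ, (∀ e, x e = 0 ∨ x e = 1) ∧ (∀ e, x e ≤ (h : ℤ) - #(A e)) ∧
      (∀ B ⊆ M, #B < h → ∑ e with A e = B, x e = (l * (n - #M - 1).choose (h - #B - 1) : ℕ)) ∧
      (∀ i, ∑ e with color e = i, x e = r i) ∧
      (∀ q, |(n - #M : ℕ) * ∑ e with lab e = q, x e - ∑ e with lab e = q, ((h : ℤ) - #(A e))| <
        (n - #M : ℕ)) ∧
      (∀ i, |(n - #M : ℕ) * ∑ e with color e = i ∧
          2 ≤ ∑ e' with lab e' = lab e, ((h : ℤ) - #(A e')), x e -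
        ∑ e with color e = i ∧ 2 ≤ ∑ e' with lab e' = lab e, ((h : ℤ) - #(A e')),
          ((h : ℤ) - #(A e))| < (n - #M : ℕ)) := by
  classical
  obtain ⟨x, hx1, hxA, hxl, hxS, hxc⟩ := exists_balanced_rounding A lab
    -- The chain is block, then colour together with whether the block has at least two open places,
    -- then colour. By `color_lab` the label of a block determines its colour.
    (fun q => (color q, decide (2 ≤ ∑ e' with lab e' = q, ((h : ℤ) - #(A e'))))) Prod.fst
    (n - #M) (by omega) (fun e => (h : ℤ) - #(A e))
  have hNpos : (0 : ℤ) < (n - #M : ℕ) := by omega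
  -- An integral target is met without error; this applies to trace classes and to colours.
  have exact_of : ∀ z y : ℤ, |(n - #M : ℕ) * z - (n - #M : ℕ) * y| < (n - #M : ℕ) → z = y := by
    intro z y hzy
    rw [← mul_sub, abs_mul, abs_of_pos hNpos] at hzy
    have : |z - y| < 1 := by
      by_contra hge
      push Not at hge
      nlinarith
    rw [Int.abs_lt_one_iff] at this
    omega
  have hrange : ∀ e, (0 : ℤ) ≤ (h : ℤ) - #(A e) ∧ (h : ℤ) - #(A e) ≤ (n - #M : ℕ) := by
    intro e
    have := H.le_room e
    have := H.card_le e
    omega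
  have h01 : ∀ e, x e = 0 ∨ x e = 1 := by
    intro e
    obtain ⟨h1, h2⟩ := abs_lt.1 (hx1 e)
    obtain ⟨h3, h4⟩ := hrange e
    have h5 : -1 < x e := by
      by_contra hle
      push Not at hle
      nlinarith
    have h6 : x e < 2 := by
      by_contra hle
      push Not at hle
      nlinarith
    omega
  refine ⟨x, h01, fun e => ?_, fun B hB hBh => ?_, fun i => ?_, hxl, fun i => ?_⟩
  · obtain ⟨h1, h2⟩ := abs_lt.1 (hx1 e)
    obtain ⟨h3, h4⟩ := hrange e
    rcases h01 e with h0 | h0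
    · rw [h0]; exact h3
    · rw [h0] at h2 ⊢
      omega
  · apply exact_of
    have hsum : ∑ e with A e = B, ((h : ℤ) - #(A e)) =
        (n - #M : ℕ) * ((l * (n - #M - 1).choose (h - #B - 1) : ℕ) : ℤ) := by
      have h1 : ∀ e ∈ ({e | A e = B} : Finset E), ((h : ℤ) - #(A e)) = (h - #B : ℕ) := by
        intro e he
        rw [(mem_filter.1 he).2]
        omega
      rw [sum_congr rfl h1, sum_const, H.card_trace B hB hBh.le, nsmul_eq_mul]
      norm_cast
      obtain ⟨N, hN⟩ : ∃ N, n - #M = N + 1 := ⟨n - #M - 1, by omega⟩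
      obtain ⟨j, hj⟩ : ∃ j, h - #B = j + 1 := ⟨h - #B - 1, by omega⟩
      rw [hN, hj, Nat.add_sub_cancel, Nat.add_sub_cancel, mul_assoc, ← Nat.add_one_mul_choose_eq]
      ring
    rw [← hsum]
    exact hxA B
  · apply exact_of
    have h1 := hxc i
    simp only [H.color_lab] at h1
    rwa [H.sum_room hM.le i (hcol i)] at h1
  · have h1 := hxS (i, true)
    simpa only [H.color_lab, Prod.mk.injEq, decide_eq_true_eq] using h1

end IsPartialFactorization

open Finset in
theorem sum_eq_card_of_zero_or_one {E : Type*} {x : E → ℤ} (h01 : ∀ e, x e = 0 ∨ x e = 1)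
    (s : Finset E) :
    ∑ e ∈ s, x e = #{e ∈ s | x e = 1} := by
  rw [card_filter]
  push_cast
  refine sum_congr rfl fun e _ => ?_
  rcases h01 e with h0 | h0 <;> simp [h0]

namespace IsPartialFactorization

open Finset

variable {V E K : Type*} [DecidableEq V] [Fintype E] [DecidableEq E]
    [DecidableEq K] {color : E → K} {r : K → ℕ} {C : Set K} {n h l : ℕ} {M : Finset V}
    {A : E → Finset V} {lab : E → E}

/-- Traces containing `v` come from the chosen edges. A trace avoiding `v` comes from the edges not
chosen, and Pascal's rule gives their number; when `#B = h` no edge of trace `B` has an open place,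
so none is chosen. -/
theorem card_trace_insert (H : IsPartialFactorization color r C n h l M A lab) (hM : #M < n)
    {v : V} (hv : v ∉ M) {x : E → ℤ} (h01 : ∀ e, x e = 0 ∨ x e = 1)
    (hxle : ∀ e, x e ≤ (h : ℤ) - #(A e))
    (hxA : ∀ B ⊆ M, #B < h →
      ∑ e with A e = B, x e = (l * (n - #M - 1).choose (h - #B - 1) : ℕ))
    {B : Finset V} (hB : B ⊆ insert v M) (hBh : #B ≤ h) :
    #{e | (if x e = 1 then insert v (A e) else A e) = B} =
      l * (n - #(insert v M)).choose (h - #B) := by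
  have hvA : ∀ e, v ∉ A e := fun e hve => hv (H.subset e hve)
  have hN : n - #(insert v M) = n - #M - 1 := by
    rw [card_insert_of_notMem hv]
    omega
  rw [hN]
  by_cases hvB : v ∈ B
  · have hB0 : B.erase v ⊆ M := by
      intro u hu
      have := hB (mem_of_mem_erase hu)
      exact (mem_insert.1 this).resolve_left (ne_of_mem_erase hu)
    have hc : #(B.erase v) + 1 = #B := card_erase_add_one hvB
    have h1 := hxA _ hB0 (by omega)
    rw [sum_eq_card_of_zero_or_one h01, Nat.cast_inj, filter_filter] at h1
    rw [show h - #B = h - #(B.erase v) - 1 by omega, ← h1]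
    congr 1
    ext e
    simp only [mem_filter, mem_univ, true_and]
    constructor
    · intro he
      split_ifs at he with hx
      · exact ⟨by rw [← he, erase_insert (hvA e)], hx⟩
      · exact absurd (he ▸ hvB) (hvA e)
    · rintro ⟨he, hx⟩
      rw [if_pos hx, he, insert_erase hvB]
  · have hBM : B ⊆ M := fun u hu =>
      (mem_insert.1 (hB hu)).resolve_left fun h => hvB (h ▸ hu)
    have h1 : #{e | (if x e = 1 then insert v (A e) else A e) = B} =
        #{e | A e = B ∧ ¬ x e = 1} := by
      congr 1
      ext e
      simp only [mem_filter, mem_univ, true_and]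
      constructor
      · intro he
        split_ifs at he with hx
        · exact absurd (he ▸ mem_insert_self v (A e)) hvB
        · exact ⟨he, hx⟩
      · rintro ⟨he, hx⟩
        rw [if_neg hx, he]
    have h2 := card_filter_add_card_filter_not (s := {e | A e = B}) (fun e => x e = 1)
    rw [H.card_trace B hBM hBh, filter_filter (fun e => A e = B) (fun e => ¬ x e = 1), ← h1] at h2
    rcases hBh.lt_or_eq with hlt | heq
    · have h3 := hxA B hBM hlt
      rw [sum_eq_card_of_zero_or_one h01, Nat.cast_inj] at h3
      obtain ⟨N, hN⟩ : ∃ N, n - #M = N + 1 := ⟨n - #M - 1, by omega⟩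
      obtain ⟨j, hj⟩ : ∃ j, h - #B = j + 1 := ⟨h - #B - 1, by omega⟩
      rw [h3, hN, hj, Nat.add_sub_cancel, Nat.add_sub_cancel, Nat.choose_succ_succ', mul_add] at h2
      rw [hN, hj, Nat.add_sub_cancel]
      omega
    · have h3 : #{e ∈ ({e | A e = B} : Finset E) | x e = 1} = 0 := by
        rw [card_eq_zero, filter_eq_empty_iff]
        intro e he hx
        have := hxle e
        rw [(mem_filter.1 he).2, hx] at this
        omega
      rw [h3, heq, Nat.sub_self, Nat.choose_zero_right, zero_add] at h2
      rw [h2, heq, Nat.sub_self, Nat.choose_zero_right]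

/-- One more vertex can be chosen. -/
theorem exists_insert [Fintype V] [Fintype K]
    (H : IsPartialFactorization color r C n h l M A lab) (hM : #M < n)
    (hcol : ∀ i, #{e | color e = i} * h = r i * n) (hr : ∀ i, 1 ≤ r i) {v : V} (hv : v ∉ M) :
    ∃ A' lab', IsPartialFactorization color r C n h l (insert v M) A' lab' := by
  classical
  obtain ⟨x, h01, hxle, hxA, hxc, hxl, hxS⟩ := H.exists_selection hM hcol
  have hvA : ∀ e, v ∉ A e := fun e hve => hv (H.subset e hve)
  have hN : n - #(insert v M) = n - #M - 1 := by
    rw [card_insert_of_notMem hv]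
    omega
  have hrep : ∀ i, ∃ e, color e = i ∧ x e = 1 := by
    intro i
    have hne : ∑ e with color e = i, x e ≠ 0 := by
      rw [hxc i]
      have := hr i
      omega
    obtain ⟨e, he, hxe⟩ := exists_ne_zero_of_sum_ne_zero hne
    exact ⟨e, (mem_filter.1 he).2, (h01 e).resolve_left hxe⟩
  choose rep hrepc hrepx using hrep
  let A' : E → Finset V := fun e => if x e = 1 then insert v (A e) else A e
  let touched : E → Prop := fun q => ∃ e, x e = 1 ∧ lab e = q
  -- The touched blocks of a colour now meet in `v`, so they merge under the label of one chosen
  -- representative.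
  let lab' : E → E := fun e => if touched (lab e) then lab (rep (color e)) else lab e
  have htrep : ∀ i, touched (lab (rep i)) := fun i => ⟨rep i, hrepx i, rfl⟩
  have hAA' : ∀ e, A e ⊆ A' e := by
    intro e
    simp only [A']
    split_ifs
    · exact subset_insert _ _
    · exact Subset.rfl
  have hvA' : ∀ e, v ∈ A' e ↔ x e = 1 := by
    intro e
    simp only [A']
    split_ifs with hx
    · simp [hx]
    · simp [hx, hvA e]
  have hcA' : ∀ e, (#(A' e) : ℤ) = #(A e) + x e := by
    intro e
    simp only [A']
    rcases h01 e with h0 | h0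
    · simp [h0]
    · simp [h0, card_insert_of_notMem (hvA e)]
  have hlinked : ∀ e e', lab e = lab e' → Relation.ReflTransGen
      (fun a b => color a = color b ∧ ¬ Disjoint (A' a) (A' b)) e e' := by
    intro e e' hee
    exact Relation.ReflTransGen.mono
      (fun a b hab => ⟨hab.1, fun hd => hab.2 (hd.mono (hAA' a) (hAA' b))⟩) _ _ (H.linked e e' hee)
  have hcollab' : ∀ e, color (lab' e) = color e := by
    intro e
    simp only [lab']
    split_ifs
    · rw [H.color_lab, hrepc]
    · exact H.color_lab e
  -- bookkeeping of the blocks of one colour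
  let D : E → ℤ := fun q => ∑ e with lab e = q, ((h : ℤ) - #(A e))
  let X : E → ℤ := fun q => ∑ e with lab e = q, x e
  have hX0 : ∀ q, X q = 0 ↔ ¬ touched q := by
    intro q
    simp only [X, touched]
    rw [sum_eq_zero_iff_of_nonneg fun e _ => by rcases h01 e with h | h <;> omega]
    constructor
    · rintro hall ⟨e, hxe, he⟩
      have := hall e (by simpa using he)
      omega
    · intro hno e he
      rcases h01 e with h | h
      · exact h
      · exact absurd ⟨e, h, (mem_filter.1 he).2⟩ hno
  have key : ∀ i ∈ C, (#{q ∈ image lab {e | color e = i} | X q = 0} : ℤ) + (n - #M : ℕ) ≤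
        r i * ((n - #M : ℕ) - 1) + 1 ∧
      (2 ≤ ((n - #M : ℕ) : ℤ) →
        1 ≤ ∑ q ∈ image lab {e | color e = i} with X q ≠ 0, (D q - X q)) := by
    intro i hi
    have hfib : ∀ q ∈ image lab {e | color e = i},
        ({e | lab e = q} : Finset E) = {e ∈ ({e | color e = i} : Finset E) | lab e = q} := by
      intro q hq
      obtain ⟨e₀, he₀, rfl⟩ := mem_image.1 hq
      rw [filter_filter]
      ext e
      simp only [mem_filter, mem_univ, true_and] at he₀ ⊢
      refine ⟨fun he => ⟨?_, he⟩, fun he => he.2⟩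
      rw [← H.color_lab e, he, H.color_lab, he₀]
    have hsum : ∀ (y : E → ℤ), ∑ q ∈ image lab {e | color e = i}, ∑ e with lab e = q, y e =
        ∑ e with color e = i, y e := by
      intro y
      rw [← sum_fiberwise_of_maps_to (s := {e | color e = i}) (t := image lab {e | color e = i})
        (g := lab) fun e he => mem_image_of_mem lab he]
      exact sum_congr rfl fun q hq => by rw [hfib q hq]
    have hsum2 : ∀ (y : E → ℤ),
        ∑ q ∈ image lab {e | color e = i} with 2 ≤ D q, ∑ e with lab e = q, y e =
        ∑ e with color e = i ∧ 2 ≤ D (lab e), y e := by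
      intro y
      rw [← filter_filter, sum_filter, sum_filter, ← sum_fiberwise_of_maps_to
        (s := {e | color e = i}) (t := image lab {e | color e = i})
        (g := lab) fun e he => mem_image_of_mem lab he]
      refine sum_congr rfl fun q hq => ?_
      rw [hfib q hq]
      split_ifs with h2
      · refine sum_congr rfl fun e he => ?_
        rw [(mem_filter.1 he).2, if_pos h2]
      · refine (sum_eq_zero fun e he => ?_).symm
        rw [(mem_filter.1 he).2, if_neg h2]
    refine card_blocks_after_merge _ D X _ _ (by omega) ?_ ?_ ?_ ?_ ?_ ?_ ?_ ?_
    · intro q hq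
      obtain ⟨e, he, rfl⟩ := mem_image.1 hq
      exact H.room i hi hM e (mem_filter.1 he).2
    · intro q _
      exact sum_nonneg fun e _ => by rcases h01 e with h | h <;> omega
    · intro q _
      exact sum_le_sum fun e _ => hxle e
    · intro q _
      exact hxl q
    · rw [hsum, H.sum_room hM.le i (hcol i)]
    · rw [hsum, hxc]
    · exact_mod_cast H.card_lab i hi
    · rw [hsum2, hsum2]
      exact hxS i
  refine ⟨A', lab', ?_, ?_, ?_, ?_, hcollab', ?_, ?_, ?_⟩
  · intro e
    simp only [A']
    split_ifs
    · exact insert_subset_insert _ (H.subset e)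
    · exact (H.subset e).trans (subset_insert _ _)
  · intro e
    have := hcA' e
    have := hxle e
    omega
  · intro B hB hBh
    exact H.card_trace_insert hM hv h01 hxle hxA hB hBh
  · intro i u hu
    rcases mem_insert.1 hu with rfl | hu
    · simp only [hvA']
      have := hxc i
      rw [sum_eq_card_of_zero_or_one h01, Nat.cast_inj, filter_filter] at this
      exact this
    · rw [← H.degree i u hu]
      congr 1
      ext e
      have huv : u ≠ v := fun h => hv (h ▸ hu)
      simp only [mem_filter, mem_univ, true_and, A']
      split_ifs <;> simp [huv]
  · intro e e' hee
    have hce : color e = color e' := by rw [← hcollab' e, hee, hcollab']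
    simp only [lab'] at hee
    split_ifs at hee with h1 h2 h2
    · obtain ⟨a, hxa, ha⟩ := h1
      obtain ⟨b, hxb, hb⟩ := h2
      refine (hlinked e a ha.symm).trans (.trans (.single ⟨?_, ?_⟩) (hlinked b e' hb))
      · rw [← H.color_lab a, ha, H.color_lab, hce, ← H.color_lab e', ← hb, H.color_lab]
      · exact not_disjoint_iff.2 ⟨v, (hvA' a).2 hxa, (hvA' b).2 hxb⟩
    · exact absurd (hee ▸ htrep _) h2
    · exact absurd (hee ▸ htrep _) h1
    · exact hlinked e e' hee
  · intro i hi
    -- The new blocks are the untouched ones and the merged one. Since N also drops by one, the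
    -- bound in `key` is precisely the invariant for the next stage.
    have hsub : image lab' {e | color e = i} ⊆
        insert (lab (rep i)) {q ∈ image lab {e | color e = i} | X q = 0} := by
      intro q hq
      obtain ⟨e, he, rfl⟩ := mem_image.1 hq
      have hei := (mem_filter.1 he).2
      simp only [lab']
      split_ifs with ht
      · rw [hei]
        exact mem_insert_self _ _
      · exact mem_insert_of_mem (mem_filter.2 ⟨mem_image_of_mem _ he, (hX0 _).2 ht⟩)
    have h1 := (card_le_card hsub).trans (card_insert_le _ _)
    have h2 := (key i hi).1
    rw [hN]
    obtain ⟨N, hN'⟩ : ∃ N, n - #M = N + 1 := ⟨n - #M - 1, by omega⟩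
    rw [hN'] at h2 ⊢
    push_cast at h2
    rw [add_sub_cancel_right] at h2
    have h3 : #{q ∈ image lab {e | color e = i} | X q = 0} + (N + 1) ≤ r i * N + 1 := by
      exact_mod_cast h2
    rw [Nat.add_sub_cancel]
    omega
  · intro i hi hlt e hei
    have hN2 : (2 : ℤ) ≤ (n - #M : ℕ) := by
      rw [card_insert_of_notMem hv] at hlt
      omega
    simp only [hcA']
    by_cases ht : touched (lab e)
    · have hle : lab' e = lab (rep i) := by simp only [lab', if_pos ht, hei]
      rw [hle]
      refine ((key i hi).2 hN2).trans ?_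
      have h1 : ∀ q, D q - X q = ∑ e with lab e = q, ((h : ℤ) - (#(A e) + x e)) := by
        intro q
        simp only [D, X]
        rw [← sum_sub_distrib]
        exact sum_congr rfl fun e _ => by ring
      simp only [h1]
      rw [← sum_biUnion fun p _ q _ hpq => disjoint_filter.2 fun e _ hp hq => hpq (hp.symm.trans hq)]
      refine sum_le_sum_of_subset_of_nonneg (fun e' he' => ?_) fun e' _ _ => ?_
      · obtain ⟨q, hq, he'⟩ := mem_biUnion.1 he'
        obtain ⟨hq, hq0⟩ := mem_filter.1 hq
        obtain ⟨e₀, he₀, rfl⟩ := mem_image.1 hq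
        have ht' : touched (lab e') := by
          rw [(mem_filter.1 he').2]
          exact not_not.1 fun hn => hq0 ((hX0 _).2 hn)
        have hc : color e' = i := by
          rw [← H.color_lab, (mem_filter.1 he').2, H.color_lab, (mem_filter.1 he₀).2]
        exact mem_filter.2 ⟨mem_univ _, by simp only [lab', if_pos ht', hc]⟩
      · have := hxle e'
        linarith
    · have hle : lab' e = lab e := by simp only [lab', if_neg ht]
      rw [hle]
      refine (H.room i hi hM e hei).trans (le_of_eq ?_)
      have hset : ({e' | lab' e' = lab e} : Finset E) = ({e' | lab e' = lab e} : Finset E) := by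
        ext e'
        simp only [mem_filter, mem_univ, true_and, lab']
        split_ifs with ht'
        · refine ⟨fun he' => absurd (he' ▸ htrep _) ht, fun he' => absurd (he' ▸ ht') ht⟩
        · rfl
      rw [hset]
      refine sum_congr rfl fun e' he' => ?_
      have : x e' = 0 := by
        refine (h01 e').resolve_right fun hx => ht ⟨e', hx, (mem_filter.1 he').2⟩
      rw [this, add_zero]

end IsPartialFactorization

/-! ### Complete hypergraphs and assembly -/

namespace MultiHypergraph

open Finset

theorem card_of_mem_complete {V : Type*} [Fintype V] {l h : ℕ} {e : Multiset V}
    (he : e ∈ (complete V l h).edges) :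
    Multiset.card e = h := by
  obtain ⟨s, hs, rfl⟩ := Multiset.mem_map.1 (Multiset.mem_of_mem_nsmul he)
  exact (mem_powersetCard.1 hs).2

variable {V : Type*} [Fintype V] [DecidableEq V]

theorem sum_degree (G : MultiHypergraph V) : ∑ v, G.degree v = (G.edges.map Multiset.card).sum := by
  unfold degree
  rw [Finset.sum_eq_multiset_sum, Multiset.sum_map_sum_map]
  congr 1
  refine Multiset.map_congr rfl fun e _ => ?_
  rw [← Finset.sum_eq_multiset_sum]
  exact Multiset.sum_count_eq_card fun a _ => mem_univ a

theorem degree_complete (l : ℕ) {h : ℕ} (hh : 1 ≤ h) (v : V) :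
    (complete V l h).degree v = l * (Fintype.card V - 1).choose (h - 1) := by
  unfold degree complete
  simp only [Multiset.map_nsmul, Multiset.sum_nsmul, Multiset.map_map, Function.comp_def,
    smul_eq_mul]
  congr 1
  change ∑ s ∈ powersetCard h univ, s.val.count v = _
  have h1 : ∀ s : Finset V, s.val.count v = if v ∈ s then 1 else 0 := fun s => by
    rw [Multiset.count_eq_of_nodup s.nodup]
    rfl
  simp only [h1]
  rw [← card_filter, ← card_univ, ← card_erase_of_mem (mem_univ v), ← card_powersetCard]
  refine card_bij' (fun s _ => s.erase v) (fun s _ => insert v s) ?_ ?_ ?_ ?_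
  · intro s hs
    obtain ⟨hs, hvs⟩ := mem_filter.1 hs
    refine mem_powersetCard.2 ⟨erase_subset_erase _ (subset_univ _), ?_⟩
    rw [card_erase_of_mem hvs, (mem_powersetCard.1 hs).2]
  · intro s hs
    obtain ⟨hs, hc⟩ := mem_powersetCard.1 hs
    have hvs : v ∉ s := fun hv => notMem_erase v univ (hs hv)
    refine mem_filter.2 ⟨mem_powersetCard.2 ⟨subset_univ _, ?_⟩, mem_insert_self _ _⟩
    rw [card_insert_of_notMem hvs, hc]
    omega
  · intro s hs
    exact insert_erase (mem_filter.1 hs).2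
  · intro s hs
    exact erase_insert fun hv => notMem_erase v univ ((mem_powersetCard.1 hs).1 hv)

theorem count_complete (l h : ℕ) (e : Multiset V) :
    (complete V l h).edges.count e = if e.Nodup ∧ Multiset.card e = h then l else 0 := by
  unfold complete
  rw [Multiset.count_nsmul]
  have hnd : ((powersetCard h (univ : Finset V)).val.map Finset.val).Nodup :=
    (powersetCard h univ).nodup.map val_injective
  rw [Multiset.count_eq_of_nodup hnd]
  have hiff : e ∈ (powersetCard h (univ : Finset V)).val.map Finset.val ↔
      e.Nodup ∧ Multiset.card e = h := by
    rw [Multiset.mem_map]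
    constructor
    · rintro ⟨s, hs, rfl⟩
      exact ⟨s.nodup, (mem_powersetCard.1 hs).2⟩
    · rintro ⟨hn, hc⟩
      exact ⟨⟨e, hn⟩, mem_powersetCard.2 ⟨subset_univ _, hc⟩, rfl⟩
  simp only [hiff]
  split_ifs <;> simp

/-- Count the incidences of one factor by vertices and by edges, then add the degrees of a single
vertex over all factors. -/
theorem IsFactorization.dvd_and_sum {n h l k : ℕ} {r : Fin k → ℕ} {F : Fin k → MultiHypergraph V}
    (hV : Fintype.card V = n) (hh : 1 ≤ h) (hn : h < n)
    (H : (complete V l h).IsFactorization r F) :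
    (∀ i, h ∣ r i * n) ∧ ∑ i, r i = l * (n - 1).choose (h - 1) := by
  constructor
  · intro i
    have h1 := sum_degree (F i)
    rw [sum_congr rfl fun v _ => (H.1 i).2 v, sum_const, card_univ, hV, smul_eq_mul,
      Multiset.map_congr rfl fun e he =>
        card_of_mem_complete (Multiset.mem_of_le (H.1 i).1 he), Multiset.map_const',
      Multiset.sum_replicate, smul_eq_mul] at h1
    rw [mul_comm, h1]
    exact dvd_mul_left _ _
  · have : Nonempty V := Fintype.card_pos_iff.1 (by omega)
    obtain ⟨v⟩ := this
    rw [← hV, ← degree_complete l hh v]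
    unfold degree
    rw [← H.2]
    have hmap : (∑ i, (F i).edges).map (fun e => e.count v) =
        ∑ i, (F i).edges.map (fun e => e.count v) :=
      map_sum (Multiset.mapAddMonoidHom fun e : Multiset V => e.count v) _ _
    have hsum : (∑ i, (F i).edges.map (fun e => e.count v)).sum =
        ∑ i, ((F i).edges.map (fun e => e.count v)).sum :=
      map_sum (Multiset.sumAddMonoidHom : Multiset ℕ →+ ℕ) _ _
    rw [hmap, hsum]
    exact sum_congr rfl fun i _ => ((H.1 i).2 v).symm

/-- The condition for connectedness is the block bound at the empty stage, where each of the `r i *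
n / h` edges of colour `i` is its own block. -/
theorem exists_factorization {n h l k : ℕ} {r : Fin k → ℕ} (hV : Fintype.card V = n) (hh : 1 ≤ h)
    (hn : h < n) (hr : ∀ i, 1 ≤ r i) (hdvd : ∀ i, h ∣ r i * n)
    (hsum : ∑ i, r i = l * (n - 1).choose (h - 1)) :
    ∃ F : Fin k → MultiHypergraph V, (complete V l h).IsFactorization r F ∧
      ∀ i, r i * n / h + n ≤ r i * n + 1 → (F i).Connected := by
  classical
  let E := Σ i : Fin k, Fin (r i * n / h)
  have hcolcard : ∀ i, #{e : E | e.1 = i} = r i * n / h := by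
    intro i
    have : ({e : E | e.1 = i} : Finset E) = univ.map (Function.Embedding.sigmaMk i) := by
      ext ⟨j, e⟩
      simp only [mem_filter, mem_univ, true_and, mem_map]
      constructor
      · rintro rfl
        exact ⟨e, rfl⟩
      · rintro ⟨a, ha⟩
        exact (congrArg Sigma.fst ha).symm
    rw [this, card_map, card_univ, Fintype.card_fin]
  have hcol : ∀ i, #{e : E | e.1 = i} * h = r i * n := fun i => by
    rw [hcolcard, Nat.div_mul_cancel (hdvd i)]
  have hcardE : Fintype.card E = l * n.choose h := by
    refine Nat.eq_of_mul_eq_mul_right (show 0 < h by omega) ?_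
    rw [Fintype.card_sigma, sum_mul]
    simp only [Fintype.card_fin, Nat.div_mul_cancel (hdvd _)]
    rw [← sum_mul, hsum]
    obtain ⟨m, rfl⟩ : ∃ m, n = m + 1 := ⟨n - 1, by omega⟩
    obtain ⟨j, rfl⟩ : ∃ j, h = j + 1 := ⟨h - 1, by omega⟩
    rw [Nat.add_sub_cancel, Nat.add_sub_cancel, mul_assoc, mul_assoc, ← Nat.add_one_mul_choose_eq,
      mul_comm (m.choose j)]
  have hstage : ∀ M : Finset V, ∃ A lab, IsPartialFactorization (E := E) Sigma.fst r
      {i | r i * n / h + n ≤ r i * n + 1} n h l M A lab := by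
    intro M
    induction M using Finset.induction_on with
    | empty =>
      refine ⟨fun _ => ∅, id, fun _ => Subset.rfl, fun _ => by simp, ?_, by simp, fun _ => rfl,
        ?_, ?_, ?_⟩
      · intro B hB _
        rw [subset_empty.1 hB]
        simpa using hcardE
      · rintro e _ rfl
        exact .refl
      · intro i hi
        rw [image_id, hcolcard]
        simpa using hi
      · intro i _ _ e _
        simp [filter_eq']
        omega
    | insert v M hv ih =>
      obtain ⟨A, lab, H⟩ := ih
      refine H.exists_insert ?_ hcol hr hv
      rw [← hV]
      exact card_lt_univ_of_notMem hv
  obtain ⟨A, lab, H⟩ := hstage univ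
  -- With no vertices left, no edge has an open place and the binomial factor is C(0,0) = 1.
  have hcount : ∀ B : Finset V, #{e | A e = B} = if #B = h then l else 0 := by
    intro B
    split_ifs with hB
    · rw [H.card_trace B (subset_univ _) hB.le, card_univ, hV, hB]
      simp
    · rw [card_eq_zero, filter_eq_empty_iff]
      intro e _ he
      have h1 := H.le_room e
      have h2 := H.card_le e
      rw [card_univ, hV, he] at h1
      rw [he] at h2
      omega
  have hsumF : ∑ i, Multiset.map (fun e => (A e).val) ({e | e.1 = i} : Finset E).val =
      (complete V l h).edges := by
    have hall : ∑ i, Multiset.map (fun e => (A e).val) ({e | e.1 = i} : Finset E).val =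
        Multiset.map (fun e => (A e).val) (univ : Finset E).val := by
      have hs : ∀ s : Finset E, Multiset.map (fun e => (A e).val) s.val =
          ∑ e ∈ s, {(A e).val} := by
        intro s
        rw [Finset.sum_eq_multiset_sum, ← Multiset.sum_map_singleton (Multiset.map _ s.val),
          Multiset.map_map]
        rfl
      simp only [hs]
      exact sum_fiberwise _ _ _
    rw [hall]
    ext e
    rw [count_complete]
    by_cases hnd : e.Nodup
    · have h1 := hcount ⟨e, hnd⟩
      rw [Multiset.count_map]
      simp only [hnd, true_and]
      refine Eq.trans ?_ h1
      change #{a | e = (A a).val} = _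
      congr 1
      ext a
      simp only [mem_filter, mem_univ, true_and]
      rw [← val_inj, eq_comm]
    · rw [if_neg fun h => hnd h.1, Multiset.count_eq_zero]
      intro hmem
      obtain ⟨a, _, rfl⟩ := Multiset.mem_map.1 hmem
      exact hnd (A a).nodup
  refine ⟨fun i => ⟨Multiset.map (fun e => (A e).val) ({e | e.1 = i} : Finset E).val⟩,
    ⟨fun i => ⟨?_, fun v => ?_⟩, hsumF⟩, fun i hi => ?_⟩
  · rw [← hsumF]
    exact single_le_sum (f := fun i => Multiset.map (fun e => (A e).val)
      ({e | e.1 = i} : Finset E).val) (fun _ _ => Multiset.zero_le _) (mem_univ i)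
  · rw [← H.degree i v (mem_univ v)]
    unfold degree
    rw [Multiset.map_map]
    change ∑ e ∈ ({e | e.1 = i} : Finset E), (A e).val.count v = _
    rw [← filter_filter, card_filter]
    refine sum_congr rfl fun e _ => ?_
    rw [Multiset.count_eq_of_nodup (A e).nodup]
    rfl
  · refine ⟨Fintype.card_pos_iff.1 (by omega), fun u v => ?_⟩
    have hmem : ∀ u, ∃ e : E, e.1 = i ∧ u ∈ A e := by
      intro u
      have h1 := H.degree i u (mem_univ u)
      have h2 : 0 < #{e : E | e.1 = i ∧ u ∈ A e} := h1 ▸ hr i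
      obtain ⟨e, he⟩ := card_pos.1 h2
      exact ⟨e, (mem_filter.1 he).2⟩
    obtain ⟨e, hei, hue⟩ := hmem u
    obtain ⟨e', hei', hve'⟩ := hmem v
    -- At `M = univ` the block bound reads: at most one block.
    have hlab : lab e = lab e' := by
      have h1 := H.card_lab i hi
      rw [card_univ, hV, Nat.sub_self, mul_zero, add_zero, zero_add] at h1
      exact card_le_one.1 h1 _ (mem_image_of_mem _ (by simpa using hei)) _
        (mem_image_of_mem _ (by simpa using hei'))
    have hchain : ∀ b, Relation.ReflTransGen
        (fun a b : E => a.1 = b.1 ∧ ¬ Disjoint (A a) (A b)) e b → b.1 = i ∧ ∀ w ∈ A b,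
        Relation.ReflTransGen (Joined ⟨Multiset.map (fun e => (A e).val)
          ({e | e.1 = i} : Finset E).val⟩) u w := by
      have hjoin : ∀ b : E, b.1 = i → ∀ w ∈ A b, ∀ w' ∈ A b, Joined ⟨Multiset.map
          (fun e => (A e).val) ({e | e.1 = i} : Finset E).val⟩ w w' := fun b hb w hw w' hw' =>
        ⟨(A b).val, Multiset.mem_map.2 ⟨b, by simpa using hb, rfl⟩, hw, hw'⟩
      intro b hb
      induction hb with
      | refl => exact ⟨hei, fun w hw => .single (hjoin e hei u hue w hw)⟩
      | tail _ hstep ih =>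
        obtain ⟨hc, hd⟩ := hstep
        obtain ⟨z, hz, hz'⟩ := not_disjoint_iff.1 hd
        refine ⟨hc ▸ ih.1, fun w hw => (ih.2 z hz).tail (hjoin _ (hc ▸ ih.1) z hz' w hw)⟩
    exact (hchain e' (H.linked e e' hlab)).2 v hve'

end MultiHypergraph

theorem theorem2 {V : Type*} [Fintype V] [DecidableEq V] (n h l k : ℕ) (r : Fin k → ℕ)
    (hV : Fintype.card V = n) (hh : 1 ≤ h) (hn : h < n) (hl : 1 ≤ l) (hr : ∀ i, 1 ≤ r i) :
    ((∃ F : Fin k → MultiHypergraph V,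
        (MultiHypergraph.complete V l h).IsFactorization r F) ↔
      (∀ i, h ∣ r i * n) ∧ ∑ i, r i = l * (n - 1).choose (h - 1)) ∧
    (2 ≤ h → (∀ i, h ∣ r i * n) → ∑ i, r i = l * (n - 1).choose (h - 1) →
      ∃ F : Fin k → MultiHypergraph V,
        (MultiHypergraph.complete V l h).IsFactorization r F ∧
          ∀ i, 2 ≤ r i → (F i).Connected) := by
  refine ⟨⟨fun ⟨F, hF⟩ => hF.dvd_and_sum hV hh hn, fun ⟨hdvd, hsum⟩ => ?_⟩,
    fun hh2 hdvd hsum => ?_⟩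
  · obtain ⟨F, hF, _⟩ := MultiHypergraph.exists_factorization hV hh hn hr hdvd hsum
    exact ⟨F, hF⟩
  · obtain ⟨F, hF, hconn⟩ := MultiHypergraph.exists_factorization hV hh hn hr hdvd hsum
    refine ⟨F, hF, fun i hi => hconn i ?_⟩
    -- The bound follows from rn/h ≤ rn/2 and n ≤ rn/2, which use h ≥ 2 and r ≥ 2 respectively.
    have h1 : r i * n / h ≤ r i * n / 2 := Nat.div_le_div_left hh2 (by omega)
    have h2 : 2 * n ≤ r i * n := Nat.mul_le_mul_right n hi
    omega
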